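/- Let $G$ be a finitely generated group and let $H_1,\dots,H_n$ be finitely generated subgroups of $G$. Write $X^*=G\setminus X$ for $X\subseteq G$. For a subgroup $H\le G$, a subset of $G$ is $H$-finite if it is contained in a union of finitely many cosets $Hg$. A subset $X\subseteq G$ is $H$-almost invariant if $hX=X$ for all $h\in H$ and, for every $g\in G$, the subsets $(H\backslash X)g$ and $H\backslash X$ of $H\backslash G$ have finite symmetric difference; it is nontrivial if $H\backslash X$ and $H\backslash X^*$ are both infinite. An $H$-almost invariant set $X$ and a $K$-almost invariant set $Z$ are equivalent if their symmetric difference is $H$-finite. The corners of a pair $(U,V)$ of subsets of $G$ are $U\cap V$, $U^*\cap V$, $U\cap V^*$, $U^*\cap V^*$. If $U$ is $L$-almost invariant, then $U$ and $V$ cross if no corner is $L$-finite; they are nested if some corner is empty; and $U\le V$ (almost inclusion) means that $U\cap V^*$ is empty or is the only $L$-finite one among the four corners. For $i=1,\dots,n$ let $X_i$ be a nontrivial $H_i$-almost invariant subset of $G$. Then there are subgroups $K_1,\dots,K_n$ of $G$ and nontrivial $K_i$-almost invariant subsets $Z_i$ of $G$ such that each $Z_i$ is equivalent to $X_i$ and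 the family $Z_1,\dots,Z_n$ is in very good position: any two elements of $E(Z)=\{gZ_i,\,gZ_i^* : g\in G,\ 1\le i\le n\}$ either cross or are nested, where $gZ_i$ and $gZ_i^*$ are regarded as almost invariant over $gK_ig^{-1}$. Consequently, for all $U,V\in E(Z)$, one has $U\le V$ if and only if $U\subseteq V$. -/

import Mathlib

open scoped Pointwise

namespace AlmostInv

variable {G : Type*} [Group G]

/-- The set `H\G` of cosets `Hg`, the quotient of `G` by left multiplication by `H`. -/
abbrev Cosets (H : Subgroup G) : Type _ := Quotient (QuotientGroup.rightRel H)

/-- The image `H\X` in `H\G` of a subset `X` of `G`. -/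
def proj (H : Subgroup G) (X : Set G) : Set (Cosets H) :=
  (fun x => (Quotient.mk (QuotientGroup.rightRel H) x : Cosets H)) '' X

/-- The right action of `G` on `H\G`: the element `g` sends `Hx` to `Hxg`. -/
def cosetMulRight (H : Subgroup G) (g : G) : Cosets H → Cosets H :=
  Quotient.map (fun x => x * g) (by
    intro a b hab
    have h : b * a⁻¹ ∈ H := QuotientGroup.rightRel_apply.mp hab
    exact QuotientGroup.rightRel_apply.mpr (by simpa [mul_assoc] using h))

/-- `X` is `H`-almost invariant: `hX = X` for all `h ∈ H`, and `P = H\X` is an almost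
invariant subset of `H\G`, i.e. `Pg` and `P` have finite symmetric difference for all `g`. -/
def IsAlmostInvariant (H : Subgroup G) (X : Set G) : Prop :=
  (∀ h ∈ H, h • X = X) ∧
    ∀ g : G, (symmDiff (cosetMulRight H g '' proj H X) (proj H X)).Finite

/-- `X` is a nontrivial `H`-almost invariant set: moreover `H\X` and `H\Xᶜ` are infinite. -/
def IsNontrivialAlmostInvariant (H : Subgroup G) (X : Set G) : Prop :=
  IsAlmostInvariant H X ∧ (proj H X).Infinite ∧ (proj H Xᶜ).Infinite

/-- `W` is `H`-finite: it is contained in the union of finitely many cosets `Hg`. -/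
def HFinite (H : Subgroup G) (W : Set G) : Prop :=
  ∃ F : Finset G, W ⊆ (H : Set G) * (F : Set G)

/-- The `H`-almost invariant set `X` and the `K`-almost invariant set `Y` are equivalent:
their symmetric difference is `H`-finite. -/
def Equivalent (H : Subgroup G) (X : Set G) (K : Subgroup G) (Y : Set G) : Prop :=
  IsAlmostInvariant H X ∧ IsAlmostInvariant K Y ∧ HFinite H (symmDiff X Y)

/-- `V` crosses the `L`-almost invariant set `U`: none of the four corners is `L`-finite. -/
def Crosses (L : Subgroup G) (U V : Set G) : Prop :=
  ¬ HFinite L (U ∩ V) ∧ ¬ HFinite L (Uᶜ ∩ V) ∧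
    ¬ HFinite L (U ∩ Vᶜ) ∧ ¬ HFinite L (Uᶜ ∩ Vᶜ)

/-- `U` and `V` are nested: one of the four corners is empty. -/
def Nested (U V : Set G) : Prop :=
  U ∩ V = ∅ ∨ Uᶜ ∩ V = ∅ ∨ U ∩ Vᶜ = ∅ ∨ Uᶜ ∩ Vᶜ = ∅

/-- Almost inclusion `U ≤ V`, where `U` is an `L`-almost invariant set: `U ∩ Vᶜ` is empty or is
the only small (that is, `L`-finite) one among the four corners. -/
def AlmostLE (L : Subgroup G) (U V : Set G) : Prop :=
  U ∩ Vᶜ = ∅ ∨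
    (HFinite L (U ∩ Vᶜ) ∧ ¬ HFinite L (U ∩ V) ∧
      ¬ HFinite L (Uᶜ ∩ V) ∧ ¬ HFinite L (Uᶜ ∩ Vᶜ))

/-- `U` belongs to `E(Z) = {gZ_i, (gZ_i)ᶜ}`, and `L = gK_ig⁻¹` is the group over which `U` is
almost invariant, given that each `Z_i` is `K_i`-almost invariant. -/
def MemE {ι : Type*} (K : ι → Subgroup G) (Z : ι → Set G) (L : Subgroup G) (U : Set G) : Prop :=
  ∃ (i : ι) (g : G), L = MulAut.conj g • K i ∧ (U = g • Z i ∨ U = (g • Z i)ᶜ)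

/-- The family of `K_i`-almost invariant sets `Z_i` is in very good position: any two elements
of `E(Z)` cross or are nested. -/
def VeryGoodPosition {ι : Type*} (K : ι → Subgroup G) (Z : ι → Set G) : Prop :=
  ∀ (L M : Subgroup G) (U V : Set G), MemE K Z L U → MemE K Z M V →
    Crosses L U V ∨ Nested U V

end AlmostInv

open scoped Pointwise

namespace AlmostInv

variable {G : Type*} [Group G]

open MulAction (stabilizer)

/-! Almost inclusion need not order the translates of the `X i` and their complements: two of them
may have both differences small. `SizeLE` breaks such ties: `U` precedes `V` if `U \ V` is small
and, when `V \ U` is small too, `U \ V` has at most as many cosets of the common stabilizer as `V \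
U`. This behaves like comparing sizes, so it is transitive (`SizeLE.trans`), invariant under
translation and reversed by complements; two sets are comparable as soon as one difference is small
(`SizeLE.total`).

Choose an ultrafilter `w` for this preorder that approximates the principal one at `1`: it contains
every translate or complement that contains `1`, unless that set precedes the complement of another
such set. Then `Z i = {g | g⁻¹ • X i ∈ w}` is the half-space of `X i` pulled back along the orbit of
a vertex of the dual cubing.

`Z i` is equivalent to `X i` over the same group `H i`. Where they disagree, a translate of `X i` or
of its complement contains `1` and precedes a set that misses `1`. Such a pair is not nested, since
on nested pairs `SizeLE` implies inclusion (`SizeLE.subset_of_nested`). Finite generation leaves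
finitely many double cosets of non-nested pairs (`exists_finset_nested`), and each contributes an `H
i`-finite set of `g`.

If a pair in `E(Z)` has a small corner, the sets it comes from are comparable, up to complement, and
upward closure of `w` turns comparability into inclusion (`Represents.subset_or_subset`). -/

theorem mem_conj_smul {g x : G} {H : Subgroup G} :
    x ∈ MulAut.conj g • H ↔ g⁻¹ * x * g ∈ H := by
  rw [Subgroup.mem_pointwise_smul_iff_inv_smul_mem, ← map_inv, MulAut.smul_def,
    MulAut.conj_apply, inv_inv]

/-! ### Finite unions of cosets -/

namespace HFinite

variable {H K : Subgroup G} {A B : Set G}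

theorem iff_exists : HFinite H A ↔ ∃ F : Finset G, ∀ x ∈ A, ∃ h ∈ H, ∃ f ∈ F, x = h * f := by
  refine exists_congr fun F => forall₂_congr fun x _ => ?_
  simp only [Set.mem_mul, SetLike.mem_coe, eq_comm]

theorem mono (hB : HFinite H B) (h : A ⊆ B) : HFinite H A := by
  obtain ⟨F, hF⟩ := hB
  exact ⟨F, h.trans hF⟩

theorem empty : HFinite H (∅ : Set G) := ⟨∅, Set.empty_subset _⟩

theorem union (hA : HFinite H A) (hB : HFinite H B) : HFinite H (A ∪ B) := by
  classical
  obtain ⟨F, hF⟩ := hA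
  obtain ⟨F', hF'⟩ := hB
  refine ⟨F ∪ F', ?_⟩
  rw [Finset.coe_union, Set.mul_union]
  exact Set.union_subset_union hF hF'

theorem biUnion {ι : Type*} (s : Finset ι) {A : ι → Set G} (h : ∀ i ∈ s, HFinite H (A i)) :
    HFinite H (⋃ i ∈ s, A i) := by
  classical
  induction s using Finset.induction_on with
  | empty => simpa using empty
  | insert a s _ ih =>
    rw [Finset.set_biUnion_insert]
    exact (h a (Finset.mem_insert_self _ _)).union
      (ih fun i hi => h i (Finset.mem_insert_of_mem hi))

theorem mul_right (hA : HFinite H A) (g : G) : HFinite H {x | x * g ∈ A} := by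
  classical
  obtain ⟨F, hF⟩ := iff_exists.1 hA
  refine iff_exists.2 ⟨F.image (· * g⁻¹), fun x hx => ?_⟩
  obtain ⟨h, hh, f, hf, e⟩ := hF _ hx
  exact ⟨h, hh, f * g⁻¹, Finset.mem_image_of_mem _ hf, by rw [← mul_assoc, ← e]; simp⟩

theorem trans (hK : HFinite H (K : Set G)) (hA : HFinite K A) : HFinite H A := by
  classical
  obtain ⟨F, hF⟩ := iff_exists.1 hK
  obtain ⟨F', hF'⟩ := iff_exists.1 hA
  refine iff_exists.2 ⟨F * F', fun x hx => ?_⟩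
  obtain ⟨k, hk, f', hf', rfl⟩ := hF' x hx
  obtain ⟨h, hh, f, hf, rfl⟩ := hF k hk
  exact ⟨h, hh, f * f', Finset.mul_mem_mul hf hf', mul_assoc _ _ _⟩

theorem of_le (hHK : H ≤ K) (hA : HFinite H A) : HFinite K A := by
  obtain ⟨F, hF⟩ := hA
  exact ⟨F, hF.trans (Set.mul_subset_mul_right hHK)⟩

theorem smul (hA : HFinite H A) (g : G) : HFinite (MulAut.conj g • H) (g • A) := by
  classical
  obtain ⟨F, hF⟩ := iff_exists.1 hA
  refine iff_exists.2 ⟨F.image (g * ·), fun x hx => ?_⟩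
  obtain ⟨h, hh, f, hf, e⟩ := hF _ (Set.mem_smul_set_iff_inv_smul_mem.1 hx)
  refine ⟨g * h * g⁻¹, mem_conj_smul.2 (by simpa [mul_assoc] using hh), g * f,
    Finset.mem_image_of_mem _ hf, ?_⟩
  rw [smul_eq_mul, inv_mul_eq_iff_eq_mul] at e
  simp [e, mul_assoc]

theorem smul_iff (g : G) : HFinite (MulAut.conj g • H) (g • A) ↔ HFinite H A := by
  refine ⟨fun h => ?_, fun h => h.smul g⟩
  simpa using h.smul g⁻¹

/-- If `A` is `H`-finite, contained in a set `B` that is almost invariant over `L`, and some coset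
of `H` avoids `B`, then `A` is also `L`-finite. -/
theorem of_coset_subset {L : Subgroup G} (hA : HFinite H A)
    (hB : ∀ g : G, HFinite L {x | x ∈ A ∧ x * g ∉ B}) {y : G} (hy : ∀ h ∈ H, h * y ∉ B) :
    HFinite L A := by
  obtain ⟨F, hF⟩ := iff_exists.1 hA
  -- Right multiplication by `f⁻¹ * y` carries `x = h * f` to `h * y`, which is outside `B`.
  refine (biUnion F fun f _ => hB (f⁻¹ * y)).mono fun x hx => ?_
  obtain ⟨h, hh, f, hf, e⟩ := hF x hx
  simp only [Set.mem_iUnion]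
  refine ⟨f, hf, hx, ?_⟩
  rw [e]
  simpa [mul_assoc] using hy h hh

end HFinite

/-! ### Almost invariance expressed inside `G` -/

theorem proj_finite_iff {H : Subgroup G} {A : Set G} : (proj H A).Finite ↔ HFinite H A := by
  classical
  constructor
  · intro h
    refine HFinite.iff_exists.2 ⟨h.toFinset.image Quotient.out, fun x hx => ?_⟩
    let q : Cosets H := Quotient.mk (QuotientGroup.rightRel H) x
    have hq : q ∈ proj H A := ⟨x, hx, rfl⟩
    have hr : x * q.out⁻¹ ∈ H :=
      QuotientGroup.rightRel_apply.1 (Quotient.exact (Quotient.out_eq q))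
    exact ⟨_, hr, q.out, Finset.mem_image_of_mem _ (h.mem_toFinset.2 hq), by simp⟩
  · rintro ⟨F, hF⟩
    refine (F.finite_toSet.image
      (fun x => (Quotient.mk (QuotientGroup.rightRel H) x : Cosets H))).subset ?_
    rintro _ ⟨x, hx, rfl⟩
    obtain ⟨h, hh, f, hf, rfl⟩ := hF hx
    refine ⟨f, hf, Quotient.sound (QuotientGroup.rightRel_apply.2 ?_)⟩
    simpa using hh

theorem mem_proj_iff {H : Subgroup G} {A : Set G} (hA : ∀ h ∈ H, ∀ x, h * x ∈ A ↔ x ∈ A) {x : G} :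
    (Quotient.mk (QuotientGroup.rightRel H) x : Cosets H) ∈ proj H A ↔ x ∈ A := by
  refine ⟨?_, fun h => ⟨x, h, rfl⟩⟩
  rintro ⟨y, hy, e⟩
  have h : x * y⁻¹ ∈ H := QuotientGroup.rightRel_apply.1 (Quotient.exact e)
  simpa [hy] using hA _ h y

/-- A reformulation of nontrivial almost invariance that does not mention `H\G`. -/
structure IsAI (H : Subgroup G) (X : Set G) : Prop where
  mul_mem_iff : ∀ h ∈ H, ∀ x, h * x ∈ X ↔ x ∈ X
  hfinite : ∀ g, HFinite H {x | x ∈ X ∧ x * g ∉ X}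
  not_hfinite : ¬ HFinite H X
  not_hfinite_compl : ¬ HFinite H Xᶜ

theorem symmDiff_proj {H : Subgroup G} {X : Set G} (hX : ∀ h ∈ H, ∀ x, h * x ∈ X ↔ x ∈ X) (g : G) :
    symmDiff (cosetMulRight H g '' proj H X) (proj H X) =
      proj H {x | ¬ (x * g⁻¹ ∈ X ↔ x ∈ X)} := by
  have h1 : ∀ h ∈ H, ∀ x, h * x ∈ {x | x * g⁻¹ ∈ X} ↔ x ∈ {x | x * g⁻¹ ∈ X} :=
    fun h hh x => by simpa [mul_assoc] using hX h hh (x * g⁻¹)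
  have h2 : ∀ h ∈ H, ∀ x, h * x ∈ {x | ¬ (x * g⁻¹ ∈ X ↔ x ∈ X)} ↔
      x ∈ {x | ¬ (x * g⁻¹ ∈ X ↔ x ∈ X)} := fun h hh x => by
    simp only [Set.mem_ofPred_eq, mul_assoc, hX h hh]
  have e : cosetMulRight H g '' proj H X = proj H {x | x * g⁻¹ ∈ X} := by
    ext q
    constructor
    · rintro ⟨_, ⟨x, hx, rfl⟩, rfl⟩
      exact ⟨x * g, by simpa using hx, rfl⟩
    · rintro ⟨x, hx, rfl⟩
      refine ⟨_, ⟨x * g⁻¹, hx, rfl⟩, ?_⟩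
      change (Quotient.mk (QuotientGroup.rightRel H) (x * g⁻¹ * g) : Cosets H) = _
      simp
  rw [e]
  ext q
  induction q using Quotient.inductionOn with
  | _ x =>
    rw [Set.mem_symmDiff, mem_proj_iff h1, mem_proj_iff hX, mem_proj_iff h2]
    simp only [Set.mem_ofPred_eq]
    tauto

theorem isNontrivialAlmostInvariant_iff {H : Subgroup G} {X : Set G} :
    IsNontrivialAlmostInvariant H X ↔ IsAI H X := by
  have key : (∀ h ∈ H, h • X = X) ↔ ∀ h ∈ H, ∀ x, h * x ∈ X ↔ x ∈ X := by
    refine ⟨fun hX h hh x => ?_, fun hX h hh => Set.ext fun x => ?_⟩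
    · conv_lhs => rw [← hX h hh]
      rw [← smul_eq_mul, Set.smul_mem_smul_set_iff]
    · rw [Set.mem_smul_set_iff_inv_smul_mem, smul_eq_mul, hX _ (H.inv_mem hh)]
  simp only [IsNontrivialAlmostInvariant, IsAlmostInvariant, key, Set.Infinite, proj_finite_iff]
  constructor
  · rintro ⟨⟨h1, h2⟩, h3, h4⟩
    refine ⟨h1, fun g => ?_, h3, h4⟩
    have h := h2 g⁻¹
    rw [symmDiff_proj h1, proj_finite_iff] at h
    exact h.mono fun x hx => by simp [hx.1, hx.2]
  · rintro ⟨h1, h2, h3, h4⟩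
    refine ⟨⟨h1, fun g => ?_⟩, h3, h4⟩
    rw [symmDiff_proj h1, proj_finite_iff]
    refine ((h2 g⁻¹).union ((h2 g).mul_right g⁻¹)).mono fun x hx => ?_
    simp only [Set.mem_ofPred_eq, Set.mem_union, inv_mul_cancel_right] at hx ⊢
    tauto

/-! ### Small differences and change of group -/

namespace IsAI

variable {H L M N : Subgroup G} {X U V W : Set G}

theorem compl (h : IsAI H X) : IsAI H Xᶜ where
  mul_mem_iff k hk x := not_congr (h.mul_mem_iff k hk x)
  hfinite g := ((h.hfinite g⁻¹).mul_right g).mono fun x hx => by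
    simp only [Set.mem_ofPred_eq, Set.mem_compl_iff, not_not, mul_inv_cancel_right] at hx ⊢
    tauto
  not_hfinite := h.not_hfinite_compl
  not_hfinite_compl := by rw [compl_compl]; exact h.not_hfinite

theorem smul (h : IsAI H X) (g : G) : IsAI (MulAut.conj g • H) (g • X) where
  mul_mem_iff k hk x := by
    simp only [Set.mem_smul_set_iff_inv_smul_mem, smul_eq_mul]
    rw [← h.mul_mem_iff _ (mem_conj_smul.1 hk) (g⁻¹ * x)]
    simp [mul_assoc]
  hfinite k := by
    refine ((h.hfinite k).smul g).mono fun x hx => ?_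
    simpa only [Set.mem_smul_set_iff_inv_smul_mem, smul_eq_mul, mul_assoc, Set.mem_ofPred_eq]
      using hx
  not_hfinite := by rw [HFinite.smul_iff]; exact h.not_hfinite
  not_hfinite_compl := by rw [← Set.smul_set_compl, HFinite.smul_iff]; exact h.not_hfinite_compl

/-- If no coset of `L` lay in `U ∩ V`, each coset in `U` would meet the `L`-finite set `U \ V`, and
`U` itself would be `L`-finite. -/
theorem exists_coset_subset (hU : IsAI L U) (h : HFinite L (U \ V)) :
    ∃ y, ∀ l ∈ L, l * y ∈ U ∩ V := by
  obtain ⟨F, hF⟩ := h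
  by_contra! hy
  refine hU.not_hfinite ⟨F, fun x hx => ?_⟩
  obtain ⟨l, hl, hlx⟩ := hy x
  have hlU : l * x ∈ U := (hU.mul_mem_iff l hl x).2 hx
  obtain ⟨k, hk, f, hf, e⟩ := hF ⟨hlU, fun hV => hlx ⟨hlU, hV⟩⟩
  refine ⟨l⁻¹ * k, L.mul_mem (L.inv_mem hl) hk, f, hf, ?_⟩
  change l⁻¹ * k * f = x
  change k * f = l * x at e
  rw [mul_assoc, e, inv_mul_cancel_left]

/-- Smallness of a corner does not depend on which of the two groups measures it: a coset of `L`
inside `V` allows `HFinite.of_coset_subset` to be applied with `Vᶜ`, which is almost invariant over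
`M`. -/
theorem hfinite_diff_swap (hU : IsAI L U) (hV : IsAI M V) (h : HFinite L (U \ V)) :
    HFinite M (U \ V) := by
  obtain ⟨y, hy⟩ := hU.exists_coset_subset h
  exact h.of_coset_subset (B := Vᶜ)
    (fun g => (hV.compl.hfinite g).mono fun x hx => ⟨hx.1.2, hx.2⟩)
    (fun l hl => not_not.2 (hy l hl).2)

theorem hfinite_diff_swap' (hU : IsAI L U) (hV : IsAI M V) (h : HFinite M (U \ V)) :
    HFinite L (U \ V) := by
  have e : U \ V = Vᶜ \ Uᶜ := by ext; simp [and_comm]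
  rw [e] at h ⊢
  exact hV.compl.hfinite_diff_swap hU.compl h

theorem hfinite_diff_trans (hU : IsAI L U) (hV : IsAI M V)
    (h : HFinite L (U \ V)) (h' : HFinite M (V \ W)) : HFinite L (U \ W) := by
  have hM := hU.hfinite_diff_swap hV h
  have e : U \ V = Vᶜ \ Uᶜ := by ext; simp [and_comm]
  obtain ⟨y, hy⟩ := hV.compl.exists_coset_subset (e ▸ hM)
  have hUW : HFinite M (U \ W) := (hM.union h').mono fun x hx => by
    simp only [Set.mem_union, Set.mem_sdiff] at hx ⊢; tauto
  exact hUW.of_coset_subset (B := U)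
    (fun g => (hU.hfinite g).mono fun x hx => ⟨hx.1.1, hx.2⟩) (fun l hl => (hy l hl).2)

/-- Groups over which equivalent sets are almost invariant are commensurable. -/
theorem hfinite_subgroup (hU : IsAI L U) (hV : IsAI M V) (hUN : ∀ k ∈ N, ∀ x, k * x ∈ U ↔ x ∈ U)
    (h : HFinite L (U \ V)) (h' : HFinite L (V \ U)) : HFinite M (N : Set G) := by
  have h1 : U.Nonempty := Set.nonempty_iff_ne_empty.2 fun e => hU.not_hfinite (e ▸ HFinite.empty)
  have h2 : Uᶜ.Nonempty :=
    Set.nonempty_iff_ne_empty.2 fun e => hU.not_hfinite_compl (e ▸ HFinite.empty)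
  obtain ⟨x, hx⟩ := h1
  obtain ⟨y, hy⟩ := h2
  have hM := hU.hfinite_diff_swap hV h
  have hM' := hV.hfinite_diff_swap' hU h'
  -- For `k ∈ N`, `k * x ∈ U` and `k * y ∉ U`. Hence `k * x ∈ U \ V`, or `k * y ∈ V \ U`, or right
  -- multiplication by `x⁻¹ * y` takes `k * x` out of `V`.
  have key := (((hV.hfinite (x⁻¹ * y)).union hM).union (hM'.mul_right (x⁻¹ * y))).mul_right x
  refine key.mono fun k hk => ?_
  have e1 := hUN k hk x
  have e2 := hUN k hk y
  simp only [Set.mem_ofPred_eq, Set.mem_union, Set.mem_sdiff, Set.mem_compl_iff] at *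
  have e3 : k * x * (x⁻¹ * y) = k * y := by group
  rw [e3]
  tauto

end IsAI

/-! ### Counting cosets -/

theorem HFinite.inf {S K : Subgroup G} (h : HFinite S (K : Set G)) :
    HFinite (K ⊓ S) (K : Set G) := by
  classical
  obtain ⟨F, hF⟩ := HFinite.iff_exists.1 h
  let φ : G → G := fun f => if h : ∃ k ∈ K, ∃ s ∈ S, k = s * f then h.choose else 1
  refine HFinite.iff_exists.2 ⟨F.image φ, fun x hx => ?_⟩
  obtain ⟨s, hs, f, hf, e⟩ := hF x hx
  have hex : ∃ k ∈ K, ∃ s ∈ S, k = s * f := ⟨x, hx, s, hs, e⟩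
  have hφ : φ f = hex.choose := dif_pos hex
  obtain ⟨hk, s', hs', e'⟩ := hex.choose_spec
  rw [← hφ] at hk e'
  refine ⟨x * (φ f)⁻¹, ⟨K.mul_mem hx (K.inv_mem hk), ?_⟩, φ f, Finset.mem_image_of_mem _ hf,
    by simp⟩
  rw [e, e']
  simpa using S.mul_mem hs (S.inv_mem hs')

/-- The number of cosets of `T` that meet `A`. -/
noncomputable def cosetCount (T : Subgroup G) (A : Set G) : ℕ := (proj T A).ncard

theorem cosetCount_union {T : Subgroup G} {A B : Set G} (hA : ∀ h ∈ T, ∀ x, h * x ∈ A ↔ x ∈ A)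
    (hB : ∀ h ∈ T, ∀ x, h * x ∈ B ↔ x ∈ B) (hAB : Disjoint A B) (fA : HFinite T A)
    (fB : HFinite T B) : cosetCount T (A ∪ B) = cosetCount T A + cosetCount T B := by
  rw [cosetCount, proj, Set.image_union]
  refine Set.ncard_union_eq ?_ (proj_finite_iff.2 fA) (proj_finite_iff.2 fB)
  rw [Set.disjoint_left]
  intro q
  induction q using Quotient.inductionOn with
  | _ x =>
    intro h1 h2
    exact Set.disjoint_left.1 hAB ((mem_proj_iff hA).1 h1) ((mem_proj_iff hB).1 h2)

theorem cosetCount_smul (T : Subgroup G) (A : Set G) (g : G) :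
    cosetCount (MulAut.conj g • T) (g • A) = cosetCount T A := by
  let f : Cosets T → Cosets (MulAut.conj g • T) := Quotient.map (fun x => g * x) (by
    intro a b hab
    have h : b * a⁻¹ ∈ T := QuotientGroup.rightRel_apply.mp hab
    exact QuotientGroup.rightRel_apply.mpr (mem_conj_smul.2 (by simpa [mul_assoc] using h)))
  have hf : Function.Injective f := by
    intro p q
    induction p using Quotient.inductionOn with
    | _ a =>
      induction q using Quotient.inductionOn with
      | _ b =>
        intro e
        have h := mem_conj_smul.1 (QuotientGroup.rightRel_apply.1 (Quotient.exact e))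
        exact Quotient.sound (QuotientGroup.rightRel_apply.2 (by simpa [mul_assoc] using h))
  have e : proj (MulAut.conj g • T) (g • A) = f '' proj T A := by
    ext q
    constructor
    · rintro ⟨_, ⟨a, ha, rfl⟩, rfl⟩
      exact ⟨_, ⟨a, ha, rfl⟩, rfl⟩
    · rintro ⟨_, ⟨a, ha, rfl⟩, rfl⟩
      exact ⟨g * a, Set.smul_mem_smul_set ha, rfl⟩
  rw [cosetCount, e, Set.ncard_image_of_injective _ hf, cosetCount]

theorem cosetCount_of_le {T S : Subgroup G} (hTS : T ≤ S) (hf : HFinite T (S : Set G)) {A : Set G}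
    (hA : ∀ h ∈ S, ∀ x, h * x ∈ A ↔ x ∈ A) (fA : HFinite S A) :
    cosetCount T A = cosetCount S A * cosetCount T (S : Set G) := by
  classical
  have fT : (proj T A).Finite := proj_finite_iff.2 (hf.trans fA)
  have fS : (proj S A).Finite := proj_finite_iff.2 fA
  let f : Cosets T → Cosets S := Quotient.map id (by
    intro a b hab
    exact QuotientGroup.rightRel_apply.mpr (hTS (QuotientGroup.rightRel_apply.mp hab)))
  have hm : Set.MapsTo f fT.toFinset fS.toFinset := by
    intro q hq
    simp only [Set.Finite.coe_toFinset] at hq ⊢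
    obtain ⟨x, hx, rfl⟩ := hq
    exact ⟨x, hx, rfl⟩
  rw [cosetCount, cosetCount, Set.ncard_eq_toFinset_card _ fT, Set.ncard_eq_toFinset_card _ fS,
    Finset.card_eq_sum_card_fiberwise hm, ← smul_eq_mul, ← Finset.sum_const]
  refine Finset.sum_congr rfl fun q hq => ?_
  obtain ⟨x, hx, rfl⟩ := fS.mem_toFinset.1 hq
  have hinj : Function.Injective (cosetMulRight T x) := by
    intro p q
    induction p using Quotient.inductionOn with
    | _ a =>
      induction q using Quotient.inductionOn with
      | _ b =>
        intro e
        have h := QuotientGroup.rightRel_apply.1 (Quotient.exact e)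
        exact Quotient.sound (QuotientGroup.rightRel_apply.2 (by simpa [mul_assoc] using h))
  rw [cosetCount, ← Set.ncard_image_of_injective _ hinj, ← Set.ncard_coe_finset]
  congr 1
  ext q
  induction q using Quotient.inductionOn with
  | _ y =>
    simp only [Finset.coe_filter, Set.Finite.mem_toFinset, Set.mem_ofPred_eq]
    constructor
    · rintro ⟨-, e⟩
      have h : x * y⁻¹ ∈ S := QuotientGroup.rightRel_apply.1 (Quotient.exact e)
      refine ⟨_, ⟨y * x⁻¹, by simpa using S.inv_mem h, rfl⟩, ?_⟩
      change (Quotient.mk (QuotientGroup.rightRel T) (y * x⁻¹ * x) : Cosets T) = _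
      simp
    · rintro ⟨_, ⟨s, hs, rfl⟩, e⟩
      rw [← e]
      refine ⟨⟨s * x, (hA s hs x).2 hx, rfl⟩, Quotient.sound ?_⟩
      exact QuotientGroup.rightRel_apply.2 (by simpa using hs)

/-- Passing to a subgroup of finite index multiplies both counts by the index, so sizes may be
compared over any common finite-index subgroup. -/
theorem cosetCount_le_iff {T S : Subgroup G} (hTS : T ≤ S) (hf : HFinite T (S : Set G))
    {A B : Set G} (hA : ∀ h ∈ S, ∀ x, h * x ∈ A ↔ x ∈ A) (fA : HFinite S A)
    (hB : ∀ h ∈ S, ∀ x, h * x ∈ B ↔ x ∈ B) (fB : HFinite S B) :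
    cosetCount T A ≤ cosetCount T B ↔ cosetCount S A ≤ cosetCount S B := by
  rw [cosetCount_of_le hTS hf hA fA, cosetCount_of_le hTS hf hB fB]
  refine Nat.mul_le_mul_right_iff ?_
  exact (Set.ncard_pos (proj_finite_iff.2 hf)).2 ⟨_, 1, S.one_mem, rfl⟩

theorem cosetCount_eq_zero {T : Subgroup G} {A : Set G} (fA : HFinite T A) :
    cosetCount T A = 0 ↔ A = ∅ := by
  rw [cosetCount, Set.ncard_eq_zero (proj_finite_iff.2 fA), proj, Set.image_eq_empty]

/-! ### Stabilizers and the preorder by size -/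

theorem mul_mem_iff_of_mem_stabilizer {U : Set G} {k : G} (hk : k ∈ stabilizer G U) (x : G) :
    k * x ∈ U ↔ x ∈ U := by
  conv_lhs => rw [← MulAction.mem_stabilizer_iff.1 hk]
  rw [← smul_eq_mul, Set.smul_mem_smul_set_iff]

theorem stabilizer_smul (U : Set G) (g : G) :
    stabilizer G (g • U) = MulAut.conj g • stabilizer G U :=
  MulAction.stabilizer_smul_eq_stabilizer_map_conj g U

namespace IsAI

variable {H L M : Subgroup G} {X U V W : Set G}

theorem le_stabilizer (h : IsAI H X) : H ≤ stabilizer G X := fun k hk => by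
  rw [MulAction.mem_stabilizer_iff]
  ext x
  rw [Set.mem_smul_set_iff_inv_smul_mem, smul_eq_mul, h.mul_mem_iff _ (H.inv_mem hk)]

theorem hfinite_stabilizer (h : IsAI H X) : HFinite H (stabilizer G X : Set G) :=
  h.hfinite_subgroup h (fun _ hk => mul_mem_iff_of_mem_stabilizer hk)
    (by simpa using HFinite.empty) (by simpa using HFinite.empty)

theorem hfinite_iff_stabilizer (h : IsAI H X) {A : Set G} :
    HFinite H A ↔ HFinite (stabilizer G X) A :=
  ⟨HFinite.of_le h.le_stabilizer, h.hfinite_stabilizer.trans⟩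

theorem stabilizer (h : IsAI H X) : IsAI (stabilizer G X) X where
  mul_mem_iff _ hk := mul_mem_iff_of_mem_stabilizer hk
  hfinite g := h.hfinite_iff_stabilizer.1 (h.hfinite g)
  not_hfinite := mt h.hfinite_iff_stabilizer.2 h.not_hfinite
  not_hfinite_compl := mt h.hfinite_iff_stabilizer.2 h.not_hfinite_compl

end IsAI

/-- A preorder on almost invariant sets that refines almost inclusion: sets that are equivalent are
compared by the sizes of their differences, counted modulo the common stabilizer. -/
def SizeLE (U V : Set G) : Prop :=
  HFinite (stabilizer G U) (U \ V) ∧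
    (HFinite (stabilizer G U) (V \ U) →
      cosetCount (stabilizer G U ⊓ stabilizer G V) (U \ V) ≤
        cosetCount (stabilizer G U ⊓ stabilizer G V) (V \ U))

namespace SizeLE

variable {L M N : Subgroup G} {U V W : Set G}

theorem refl (U : Set G) : SizeLE U U := ⟨by simpa using HFinite.empty, fun _ => le_rfl⟩

theorem compl (hU : IsAI L U) (hV : IsAI M V) (h : SizeLE U V) : SizeLE Vᶜ Uᶜ := by
  have e : ∀ A B : Set G, Aᶜ \ Bᶜ = B \ A := fun A B => by ext; simp [and_comm]
  simp only [SizeLE, stabilizer_compl, e]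
  refine ⟨hU.stabilizer.hfinite_diff_swap hV.stabilizer h.1, fun h' => ?_⟩
  rw [inf_comm]
  exact h.2 (hV.stabilizer.hfinite_diff_swap hU.stabilizer h')

theorem smul (h : SizeLE U V) (g : G) : SizeLE (g • U) (g • V) := by
  simpa only [SizeLE, stabilizer_smul, ← Set.smul_set_sdiff, HFinite.smul_iff,
    ← Subgroup.smul_inf, cosetCount_smul] using h

theorem not_compl (hU : IsAI L U) : ¬ SizeLE U Uᶜ := fun h =>
  hU.stabilizer.not_hfinite (by simpa using h.1)

theorem total (hU : IsAI L U) (hV : IsAI M V) (h : HFinite (stabilizer G U) (U \ V)) :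
    SizeLE U V ∨ SizeLE V U := by
  by_cases h' : HFinite (stabilizer G U) (V \ U)
  · rcases le_total (cosetCount (stabilizer G U ⊓ stabilizer G V) (U \ V))
      (cosetCount (stabilizer G U ⊓ stabilizer G V) (V \ U)) with hle | hle
    · exact Or.inl ⟨h, fun _ => hle⟩
    · exact Or.inr ⟨hV.stabilizer.hfinite_diff_swap' hU.stabilizer h', fun _ => by
        rwa [inf_comm]⟩
  · exact Or.inl ⟨h, fun h'' => absurd h'' h'⟩

theorem diff_mul_mem_iff {T : Subgroup G} (hU : T ≤ stabilizer G U) (hV : T ≤ stabilizer G V) :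
    ∀ h ∈ T, ∀ x, h * x ∈ U \ V ↔ x ∈ U \ V := fun h hh x => by
  rw [Set.mem_sdiff, Set.mem_sdiff, mul_mem_iff_of_mem_stabilizer (hU hh),
    mul_mem_iff_of_mem_stabilizer (hV hh)]

theorem cosetCount_diff_le_iff {T S : Subgroup G} (hS : S = stabilizer G U ⊓ stabilizer G V)
    (hTS : T ≤ S) (hf : HFinite T (S : Set G)) (fA : HFinite S (U \ V)) (fB : HFinite S (V \ U)) :
    cosetCount T (U \ V) ≤ cosetCount T (V \ U) ↔
      cosetCount S (U \ V) ≤ cosetCount S (V \ U) := by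
  subst hS
  exact cosetCount_le_iff hTS hf (diff_mul_mem_iff inf_le_left inf_le_right) fA
    (diff_mul_mem_iff inf_le_right inf_le_left) fB

theorem hfinite_inf (hU : IsAI L U) (hV : IsAI M V) (h : HFinite (stabilizer G U) (U \ V))
    (h' : HFinite (stabilizer G U) (V \ U)) :
    HFinite (stabilizer G U ⊓ stabilizer G V) (stabilizer G U : Set G) :=
  (hU.stabilizer.hfinite_subgroup hV.stabilizer
    (fun _ hk => mul_mem_iff_of_mem_stabilizer hk) h h').inf

/-- Morally `|U| ≤ |V| ≤ |W|`, although these counts may be infinite. Splitting each difference by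
the third set leaves finite counts, and the inequalities add up. -/
theorem cosetCount_trans {T : Subgroup G} (hU : T ≤ stabilizer G U) (hV : T ≤ stabilizer G V)
    (hW : T ≤ stabilizer G W) (fUV : HFinite T (U \ V)) (fVU : HFinite T (V \ U))
    (fVW : HFinite T (V \ W)) (fWV : HFinite T (W \ V))
    (h : cosetCount T (U \ V) ≤ cosetCount T (V \ U))
    (h' : cosetCount T (V \ W) ≤ cosetCount T (W \ V)) :
    cosetCount T (U \ W) ≤ cosetCount T (W \ U) := by
  have inv : ∀ A B C : Set G, T ≤ stabilizer G A → T ≤ stabilizer G B → T ≤ stabilizer G C →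
      ∀ h ∈ T, ∀ x, h * x ∈ (A \ B) \ C ↔ x ∈ (A \ B) \ C := fun A B C hA hB hC h hh x => by
    simp only [Set.mem_sdiff, mul_mem_iff_of_mem_stabilizer (hA hh),
      mul_mem_iff_of_mem_stabilizer (hB hh), mul_mem_iff_of_mem_stabilizer (hC hh)]
  have inv' : ∀ A B C : Set G, T ≤ stabilizer G A → T ≤ stabilizer G B → T ≤ stabilizer G C →
      ∀ h ∈ T, ∀ x, h * x ∈ (A \ B) ∩ C ↔ x ∈ (A \ B) ∩ C := fun A B C hA hB hC h hh x => by
    simp only [Set.mem_sdiff, Set.mem_inter_iff, mul_mem_iff_of_mem_stabilizer (hA hh),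
      mul_mem_iff_of_mem_stabilizer (hB hh), mul_mem_iff_of_mem_stabilizer (hC hh)]
  have split : ∀ A B C : Set G, T ≤ stabilizer G A → T ≤ stabilizer G B → T ≤ stabilizer G C →
      HFinite T (A \ B) →
      cosetCount T (A \ B) = cosetCount T ((A \ B) \ C) + cosetCount T ((A \ B) ∩ C) :=
    fun A B C hA hB hC hf => by
      rw [← cosetCount_union (inv A B C hA hB hC) (inv' A B C hA hB hC) Set.disjoint_sdiff_inter
        (hf.mono Set.sdiff_subset) (hf.mono Set.inter_subset_left), Set.sdiff_union_inter]
  have fUW : HFinite T (U \ W) := (fUV.union fVW).mono fun x hx => by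
    simp only [Set.mem_union, Set.mem_sdiff] at hx ⊢; tauto
  have fWU : HFinite T (W \ U) := (fWV.union fVU).mono fun x hx => by
    simp only [Set.mem_union, Set.mem_sdiff] at hx ⊢; tauto
  rw [split U V W hU hV hW fUV, split V U W hV hU hW fVU] at h
  rw [split V W U hV hW hU fVW, split W V U hW hV hU fWV] at h'
  rw [split U W V hU hW hV fUW, split W U V hW hU hV fWU]
  have e1 : ∀ A B C : Set G, (A \ B) \ C = (A \ C) \ B := fun A B C => by
    ext; simp only [Set.mem_sdiff]; tauto
  have e2 : ∀ A B C : Set G, (A \ B) ∩ C = (C \ B) ∩ A := fun A B C => by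
    ext; simp only [Set.mem_sdiff, Set.mem_inter_iff]; tauto
  rw [e1 U W V, e2 U W V, e1 W U V, e2 W U V]
  rw [e2 U V W, e1 V U W] at h
  omega

/-- If `W \ U` is small as well, all three sets are equivalent and their stabilizers commensurable,
so every count can be taken over the triple intersection. -/
theorem trans (hU : IsAI L U) (hV : IsAI M V) (hW : IsAI N W) (h : SizeLE U V)
    (h' : SizeLE V W) : SizeLE U W := by
  refine ⟨hU.stabilizer.hfinite_diff_trans hV.stabilizer h.1 h'.1, fun hWU => ?_⟩
  have sU := hU.stabilizer
  have sV := hV.stabilizer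
  have sW := hW.stabilizer
  have hUV := h.1
  have hVW := h'.1
  have hWU' := sW.hfinite_diff_swap' sU hWU
  have hWV := sW.hfinite_diff_trans sU hWU' hUV
  have hVU := sV.hfinite_diff_trans sW hVW hWU'
  have hUW := sU.hfinite_diff_trans sV hUV hVW
  have c1 := h.2 (sV.hfinite_diff_swap sU hVU)
  have c2 := h'.2 (sW.hfinite_diff_swap sV hWV)
  have iUV := hfinite_inf hU hV hUV (sV.hfinite_diff_swap sU hVU)
  have iVW := hfinite_inf hV hW hVW (sW.hfinite_diff_swap sV hWV)
  have iUW := hfinite_inf hU hW hUW hWU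
  have jUV : HFinite (stabilizer G U ⊓ stabilizer G V ⊓ stabilizer G W)
      ((stabilizer G U ⊓ stabilizer G V : Subgroup G) : Set G) :=
    ((iUW.of_le inf_le_right).mono inf_le_left).inf
  have jVW : HFinite (stabilizer G U ⊓ stabilizer G V ⊓ stabilizer G W)
      ((stabilizer G V ⊓ stabilizer G W : Subgroup G) : Set G) := by
    rw [inf_assoc, inf_comm]
    exact (((hfinite_inf hV hU hVU
      (sU.hfinite_diff_swap sV hUV)).of_le inf_le_right).mono inf_le_left).inf
  have jUW : HFinite (stabilizer G U ⊓ stabilizer G V ⊓ stabilizer G W)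
      ((stabilizer G U ⊓ stabilizer G W : Subgroup G) : Set G) := by
    rw [inf_right_comm]
    exact ((iUV.of_le inf_le_right).mono inf_le_left).inf
  have fUV := iUV.trans hUV
  have fVU := iUV.trans (sV.hfinite_diff_swap sU hVU)
  have fVW := iVW.trans hVW
  have fWV := iVW.trans (sW.hfinite_diff_swap sV hWV)
  rw [← cosetCount_diff_le_iff rfl inf_le_left jUV fUV fVU] at c1
  rw [← cosetCount_diff_le_iff rfl (inf_le_inf_right _ inf_le_right) jVW fVW fWV] at c2
  rw [← cosetCount_diff_le_iff rfl (inf_le_inf_right _ inf_le_left) jUW (iUW.trans hUW)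
    (iUW.trans hWU)]
  exact cosetCount_trans (inf_le_left.trans inf_le_left) (inf_le_left.trans inf_le_right)
    inf_le_right (jUV.trans fUV) (jUV.trans fVU) (jVW.trans fVW) (jVW.trans fWV) c1 c2

/-- An empty `U ∩ V` or `Uᶜ ∩ Vᶜ` would make `U` or `Vᶜ` small. If `V \ U` is empty its count is
zero, which forces `U \ V` to be empty too. -/
theorem subset_of_nested (hU : IsAI L U) (hV : IsAI M V) (h : SizeLE U V) (hn : Nested U V) :
    U ⊆ V := by
  have sU := hU.stabilizer
  have sV := hV.stabilizer
  rcases hn with hn | hn | hn | hn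
  · refine absurd (h.1.mono fun x hx => ⟨hx, fun hxV => ?_⟩) sU.not_hfinite
    exact Set.notMem_empty x (hn ▸ ⟨hx, hxV⟩)
  · have e : V \ U = ∅ := by rw [← hn]; ext; simp [and_comm]
    have hVU : HFinite (stabilizer G U) (V \ U) := e ▸ HFinite.empty
    have hc := h.2 hVU
    have hi := hfinite_inf hU hV h.1 hVU
    rw [(cosetCount_eq_zero (hi.trans hVU)).2 e, Nat.le_zero,
      cosetCount_eq_zero (hi.trans h.1)] at hc
    exact Set.sdiff_eq_empty.1 hc
  · exact Set.sdiff_eq_empty.1 hn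
  · refine absurd ((sU.hfinite_diff_swap sV h.1).mono fun x hx => ⟨?_, hx⟩) sV.not_hfinite_compl
    by_contra hxU
    exact Set.notMem_empty x (hn ▸ ⟨hxU, hx⟩)

end SizeLE

/-! ### Finiteness of non-nested pairs -/

theorem IsAI.hfinite_ne {H : Subgroup G} {X : Set G} (h : IsAI H X) (g : G) :
    HFinite H {x | ¬ (x ∈ X ↔ x * g ∈ X)} :=
  ((h.hfinite g).union (h.compl.hfinite g)).mono fun x hx => by
    simp only [Set.mem_ofPred_eq, Set.mem_union, Set.mem_compl_iff] at hx ⊢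
    tauto

/-- Outside finitely many double cosets, the translates of an almost invariant set do not separate
a given finite union of cosets of a finitely generated subgroup. -/
theorem exists_finset_not_separating {H K : Subgroup G} (hH : H.FG) {X : Set G} (hX : IsAI K X)
    (B : Finset G) :
    ∃ F : Finset G, ∀ t : G, (∀ h ∈ H, ∀ b ∈ B, h * b ∈ t • X) ∨
      (∀ h ∈ H, ∀ b ∈ B, h * b ∉ t • X) ∨ ∃ h ∈ H, ∃ c ∈ F, ∃ k ∈ K, t = h * c * k := by
  classical
  obtain ⟨S, hS⟩ := hH
  obtain ⟨F, hF⟩ := HFinite.iff_exists.1 (HFinite.biUnion (S ∪ B) fun g _ => hX.hfinite_ne g)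
  -- If `t • X` separates `h` from `h * g`, then `t⁻¹ * h = k * f` with `f ∈ F`, so `t = h * f⁻¹ *
  -- k⁻¹`.
  refine ⟨F.image (·⁻¹), fun t => ?_⟩
  by_cases ht : ∃ h ∈ H, ∃ c ∈ F.image (·⁻¹), ∃ k ∈ K, t = h * c * k
  · exact Or.inr (Or.inr ht)
  have key : ∀ h ∈ H, ∀ g ∈ S ∪ B, (h * g ∈ t • X ↔ h ∈ t • X) := by
    intro h hh g hg
    by_contra hne
    have hmem : t⁻¹ * h ∈ ⋃ g ∈ S ∪ B, {x | ¬ (x ∈ X ↔ x * g ∈ X)} := by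
      simp only [Set.mem_iUnion]
      refine ⟨g, hg, ?_⟩
      simpa only [Set.mem_smul_set_iff_inv_smul_mem, smul_eq_mul, mul_assoc,
        Set.mem_ofPred_eq, Iff.comm] using hne
    obtain ⟨k, hk, f, hf, e⟩ := hF _ hmem
    refine ht ⟨h, hh, f⁻¹, Finset.mem_image_of_mem _ hf, k⁻¹, K.inv_mem hk, ?_⟩
    rw [inv_mul_eq_iff_eq_mul] at e
    rw [e]
    group
  have hconst : ∀ g ∈ Subgroup.closure (S : Set G), ∀ h ∈ H, (h * g ∈ t • X ↔ h ∈ t • X) := by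
    intro g hg
    induction hg using Subgroup.closure_induction with
    | mem x hx => exact fun h hh => key h hh x (Finset.mem_union_left _ hx)
    | one => simp
    | mul x y hx hy ihx ihy =>
      intro h hh
      rw [← mul_assoc, ihy _ (H.mul_mem hh (hS ▸ hx)), ihx h hh]
    | inv x hx ih =>
      intro h hh
      have := ih (h * x⁻¹) (H.mul_mem hh (H.inv_mem (hS ▸ hx)))
      rw [← this, inv_mul_cancel_right]
  have hall : ∀ h ∈ H, ∀ b ∈ B, (h * b ∈ t • X ↔ (1 : G) ∈ t • X) := by
    intro h hh b hb
    rw [key h hh b (Finset.mem_union_right _ hb)]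
    simpa using hconst h (hS.symm ▸ hh) 1 H.one_mem
  by_cases h1 : (1 : G) ∈ t • X
  · exact Or.inl fun h hh b hb => (hall h hh b hb).2 h1
  · exact Or.inr (Or.inl fun h hh b hb => mt (hall h hh b hb).1 h1)

/-- The vertices of the Cayley graph with respect to `S` that have a neighbour on the other side
of `U`. -/
def frontier (S : Set G) (U : Set G) : Set G :=
  {x | ∃ s ∈ S, ¬ (x ∈ U ↔ x * s ∈ U) ∨ ¬ (x ∈ U ↔ x * s⁻¹ ∈ U)}

theorem frontier_compl (S U : Set G) : frontier S Uᶜ = frontier S U := by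
  simp only [frontier, Set.mem_compl_iff, not_iff_not]

theorem mem_frontier_smul {S U : Set G} {g x : G} :
    x ∈ frontier S (g • U) ↔ g⁻¹ * x ∈ frontier S U := by
  simp only [frontier, Set.mem_smul_set_iff_inv_smul_mem, smul_eq_mul, mul_assoc,
    Set.mem_ofPred_eq]

theorem IsAI.hfinite_frontier {H : Subgroup G} {X : Set G} (h : IsAI H X) (S : Finset G) :
    HFinite H (frontier (S : Set G) X) :=
  (HFinite.biUnion S fun s _ => (h.hfinite_ne s).union (h.hfinite_ne s⁻¹)).mono fun x hx => by
    simp only [Set.mem_iUnion]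
    obtain ⟨s, hs, h⟩ := hx
    exact ⟨s, hs, h⟩

/-- No edge of the Cayley graph leaves `U ∩ V`, and the graph is connected. -/
theorem inter_eq_empty_or_univ {S : Set G} (hS : Subgroup.closure S = ⊤) {U V : Set G}
    (hU : ∀ x ∈ frontier S U, x ∉ V) (hV : ∀ x ∈ frontier S V, x ∉ U) :
    U ∩ V = ∅ ∨ U ∩ V = Set.univ := by
  have step : ∀ s ∈ S, ∀ x, x ∈ U ∩ V → x * s ∈ U ∩ V ∧ x * s⁻¹ ∈ U ∩ V := by
    rintro s hs x ⟨hxU, hxV⟩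
    have h1 : x ∉ frontier S U := fun h => hU x h hxV
    have h2 : x ∉ frontier S V := fun h => hV x h hxU
    simp only [frontier, Set.mem_ofPred_eq, not_exists, not_and, not_or, not_not] at h1 h2
    exact ⟨⟨(h1 s hs).1.1 hxU, (h2 s hs).1.1 hxV⟩, ⟨(h1 s hs).2.1 hxU, (h2 s hs).2.1 hxV⟩⟩
  have key : ∀ g ∈ Subgroup.closure S, ∀ x, x * g ∈ U ∩ V ↔ x ∈ U ∩ V := by
    intro g hg
    induction hg using Subgroup.closure_induction with
    | mem s hs =>
      refine fun x => ⟨fun h => ?_, fun h => (step s hs x h).1⟩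
      simpa using (step s hs _ h).2
    | one => simp
    | mul x y _ _ ihx ihy => exact fun z => by rw [← mul_assoc, ihy, ihx]
    | inv x _ ih => exact fun z => by rw [← ih (z * x⁻¹), inv_mul_cancel_right]
  rcases Set.eq_empty_or_nonempty (U ∩ V) with h | ⟨x, hx⟩
  · exact Or.inl h
  · refine Or.inr (Set.eq_univ_of_forall fun y => ?_)
    simpa using (key (x⁻¹ * y) (hS ▸ Subgroup.mem_top _) x).2 hx

/-- Only finitely many double cosets of translations produce a pair that is not nested. -/
theorem exists_finset_nested (hG : Group.FG G) {H K : Subgroup G} (hH : H.FG) (hK : K.FG)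
    {X Y : Set G} (hX : IsAI H X) (hY : IsAI K Y) :
    ∃ F : Finset G, ∀ t : G, Nested X (t • Y) ∨ ∃ h ∈ H, ∃ c ∈ F, ∃ k ∈ K, t = h * c * k := by
  classical
  obtain ⟨S, hS⟩ := hG.out
  obtain ⟨B, hB⟩ := HFinite.iff_exists.1 (hX.hfinite_frontier S)
  obtain ⟨C, hC⟩ := HFinite.iff_exists.1 (hY.hfinite_frontier S)
  obtain ⟨F, hF⟩ := exists_finset_not_separating hH hY B
  obtain ⟨F', hF'⟩ := exists_finset_not_separating hK hX C
  refine ⟨F ∪ F'.image (·⁻¹), fun t => ?_⟩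
  by_cases ht : ∃ h ∈ H, ∃ c ∈ F ∪ F'.image (·⁻¹), ∃ k ∈ K, t = h * c * k
  · exact Or.inr ht
  left
  have ne : ∀ {L : Subgroup G} {U V : Set G}, IsAI L U → U ∩ V ≠ Set.univ := by
    intro L U V hU e
    have hx : ∀ x, x ∈ U := fun x => (e ▸ Set.mem_univ x : x ∈ U ∩ V).1
    exact hU.not_hfinite_compl (HFinite.empty.mono fun x h => h (hx x))
  have sep : (∀ x ∈ frontier (S : Set G) X, x ∈ t • Y) ∨
      ∀ x ∈ frontier (S : Set G) X, x ∉ t • Y := by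
    rcases hF t with h | h | ⟨h, hh, c, hc, k, hk, e⟩
    · left
      intro x hx
      obtain ⟨a, ha, b, hb, rfl⟩ := hB x hx
      exact h a ha b hb
    · right
      intro x hx
      obtain ⟨a, ha, b, hb, rfl⟩ := hB x hx
      exact h a ha b hb
    · exact absurd ⟨h, hh, c, Finset.mem_union_left _ hc, k, hk, e⟩ ht
  have sep' : (∀ x ∈ frontier (S : Set G) (t • Y), x ∈ X) ∨
      ∀ x ∈ frontier (S : Set G) (t • Y), x ∉ X := by
    rcases hF' t⁻¹ with h | h | ⟨k, hk, c, hc, h, hh, e⟩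
    · left
      intro x hx
      obtain ⟨a, ha, b, hb, e⟩ := hC _ (mem_frontier_smul.1 hx)
      simpa [← e, Set.mem_smul_set_iff_inv_smul_mem] using h a ha b hb
    · right
      intro x hx
      obtain ⟨a, ha, b, hb, e⟩ := hC _ (mem_frontier_smul.1 hx)
      simpa [← e, Set.mem_smul_set_iff_inv_smul_mem] using h a ha b hb
    · refine absurd ⟨h⁻¹, H.inv_mem hh, c⁻¹, Finset.mem_union_right _
        (Finset.mem_image_of_mem _ hc), k⁻¹, K.inv_mem hk, ?_⟩ ht
      rw [← inv_inv t, e]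
      group
  -- Each frontier lies on one side of the other set; the four combinations of sides select the four
  -- corners that can be empty.
  rcases sep with s | s <;> rcases sep' with s' | s'
  · right; right; right
    refine (inter_eq_empty_or_univ hS ?_ ?_).resolve_right (ne hX.compl)
    · rw [frontier_compl]; exact fun x hx => not_not.2 (s x hx)
    · rw [frontier_compl]; exact fun x hx => not_not.2 (s' x hx)
  · right; right; left
    refine (inter_eq_empty_or_univ hS ?_ ?_).resolve_right (ne hX)
    · exact fun x hx => not_not.2 (s x hx)
    · rw [frontier_compl]; exact s'
  · right; left
    refine (inter_eq_empty_or_univ hS ?_ ?_).resolve_right (ne hX.compl)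
    · rw [frontier_compl]; exact s
    · exact fun x hx => not_not.2 (s' x hx)
  · left
    exact (inter_eq_empty_or_univ hS s s').resolve_right (ne hX)

theorem Nested.smul {U V : Set G} (h : Nested U V) (g : G) : Nested (g • U) (g • V) := by
  simpa only [Nested, ← Set.smul_set_compl, ← Set.smul_set_inter, Set.smul_set_eq_empty] using h

/-- Up to `H`, only finitely many translates of `X` that contain `1` precede a translate of `Y`
that does not contain `1`. -/
theorem hfinite_sizeLE_separated (hG : Group.FG G) {H K : Subgroup G} (hH : H.FG) (hK : K.FG)
    {X Y : Set G} (hX : IsAI H X) (hY : IsAI K Y) :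
    HFinite H {g | ∃ k : G, SizeLE (g⁻¹ • X) (k • Y) ∧ (1 : G) ∈ g⁻¹ • X ∧ (1 : G) ∉ k • Y} := by
  classical
  obtain ⟨F, hF⟩ := exists_finset_nested hG hH hK hX hY
  -- For a fixed representative `c`, such a `g` lies, up to `H`, in the difference `X \ c • Y`,
  -- which `SizeLE` makes small.
  have hD : ∀ c ∈ F, HFinite H {g | SizeLE X (c • Y) ∧ ∃ h ∈ H, h * g ∈ X \ c • Y} := by
    intro c _
    by_cases hc : SizeLE X (c • Y)
    · obtain ⟨A, hA⟩ := HFinite.iff_exists.1 (hX.hfinite_iff_stabilizer.2 hc.1)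
      refine HFinite.iff_exists.2 ⟨A, fun g hg => ?_⟩
      obtain ⟨-, h, hh, hg⟩ := hg
      obtain ⟨a, ha, f, hf, e⟩ := hA _ hg
      exact ⟨h⁻¹ * a, H.mul_mem (H.inv_mem hh) ha, f, hf, by rw [mul_assoc, ← e]; simp⟩
    · exact HFinite.empty.mono fun g hg => hc hg.1
  refine (HFinite.biUnion F hD).mono ?_
  rintro g ⟨k, hle, h1, h2⟩
  have hle' : SizeLE X ((g * k) • Y) := by simpa [smul_smul] using hle.smul g
  have hg1 : g ∈ X := by simpa [Set.mem_smul_set_iff_inv_smul_mem] using h1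
  have hg2 : g ∉ (g * k) • Y := by simpa [Set.mem_smul_set_iff_inv_smul_mem] using h2
  rcases hF (g * k) with hn | ⟨h, hh, c, hc, l, hl, e⟩
  · exact absurd (hle'.subset_of_nested hX (hY.smul _) hn hg1) hg2
  have hlY : l • Y = Y := hY.le_stabilizer hl
  have hhX : h⁻¹ • X = X := hX.le_stabilizer (H.inv_mem hh)
  have e' : (g * k) • Y = h • c • Y := by rw [e, ← smul_smul, ← smul_smul, hlY]
  rw [e'] at hle' hg2
  have hle'' := hle'.smul h⁻¹
  rw [hhX, inv_smul_smul] at hle''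
  simp only [Set.mem_iUnion]
  refine ⟨c, hc, hle'', h⁻¹, H.inv_mem hh, (hX.mul_mem_iff _ (H.inv_mem hh) g).2 hg1, ?_⟩
  rwa [Set.mem_smul_set_iff_inv_smul_mem] at hg2

/-! ### Ultrafilters on the translates -/

/-- In a preorder with an order-reversing involution `c` such that no `a` lies below `c a`, the
elements of `P` that are compatible with all of `P` belong to a common ultrafilter. -/
theorem exists_ultrafilter {α : Type*} {E P : Set α} {r : α → α → Prop} {c : α → α}
    (hc : ∀ a ∈ E, c a ∈ E) (hcc : ∀ a, c (c a) = a) (hrefl : ∀ a ∈ E, r a a)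
    (htrans : ∀ a ∈ E, ∀ b ∈ E, ∀ d ∈ E, r a b → r b d → r a d)
    (hanti : ∀ a ∈ E, ∀ b ∈ E, r a b → r (c b) (c a)) (hne : ∀ a ∈ E, ¬ r a (c a)) :
    ∃ w ⊆ E, (∀ a ∈ w, ∀ b ∈ E, r a b → b ∈ w) ∧ (∀ a ∈ E, a ∈ w ↔ c a ∉ w) ∧
      ∀ a ∈ E, a ∈ P → (∀ b ∈ E, b ∈ P → ¬ r a (c b)) → a ∈ w := by
  have hanti' : ∀ a ∈ E, ∀ b ∈ E, r a (c b) → r b (c a) := fun a ha b hb h => by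
    simpa [hcc] using hanti a ha _ (hc b hb) h
  let 𝒮 : Set (Set α) :=
    {w | w ⊆ E ∧ (∀ a ∈ w, ∀ b ∈ E, r a b → b ∈ w) ∧ ∀ a ∈ w, ∀ b ∈ w, ¬ r a (c b)}
  -- The upward closure of the compatible elements of `P` is consistent, and Zorn's lemma extends it
  -- to a maximal consistent up-set.
  let w₀ : Set α :=
    {a | a ∈ E ∧ ∃ a₀ ∈ E, a₀ ∈ P ∧ (∀ b ∈ E, b ∈ P → ¬ r a₀ (c b)) ∧ r a₀ a}
  have hw₀ : w₀ ∈ 𝒮 := by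
    refine ⟨fun a ha => ha.1, ?_, ?_⟩
    · rintro a ⟨ha, a₀, h0, hP, hg, h⟩ b hb hab
      exact ⟨hb, a₀, h0, hP, hg, htrans _ h0 _ ha _ hb h hab⟩
    · rintro a ⟨ha, a₀, ha₀, -, hga, h⟩ b ⟨hb, b₀, hb₀, hP, -, h'⟩ hab
      exact hga b₀ hb₀ hP (htrans _ ha₀ _ ha _ (hc _ hb₀) h
        (htrans _ ha _ (hc _ hb) _ (hc _ hb₀) hab (hanti _ hb₀ _ hb h')))
  obtain ⟨w, hw₀w, hw⟩ := zorn_subset_nonempty 𝒮 (by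
    intro C hC hchain _
    refine ⟨⋃₀ C, ⟨Set.sUnion_subset fun s hs => (hC hs).1, ?_, ?_⟩,
      fun s hs => Set.subset_sUnion_of_mem hs⟩
    · rintro a ⟨s, hs, ha⟩ b hb hab
      exact ⟨s, hs, (hC hs).2.1 a ha b hb hab⟩
    · rintro a ⟨s, hs, ha⟩ b ⟨t, ht, hb⟩
      rcases hchain.total hs ht with hst | hst
      · exact (hC ht).2.2 a (hst ha) b hb
      · exact (hC hs).2.2 a ha b (hst hb)) w₀ hw₀
  obtain ⟨hwE, hup, hcons⟩ := hw.prop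
  refine ⟨w, hwE, hup, fun a ha => ⟨fun h h' => ?_, fun h => ?_⟩, fun a ha hP hg =>
    hw₀w ⟨ha, a, ha, hP, hg, hrefl a ha⟩⟩
  · exact hcons a h _ h' (by rw [hcc]; exact hrefl a ha)
  · have hlow : ∀ x ∈ w, ¬ r x (c a) := fun x hx hr => h (hup x hx _ (hc a ha) hr)
    -- If `c a ∉ w`, nothing in `w` lies below `c a`, so adjoining everything above `a` keeps
    -- consistency; maximality then gives `a ∈ w`.
    have hw' : w ∪ {b | b ∈ E ∧ r a b} ∈ 𝒮 := by
      refine ⟨Set.union_subset hwE fun b hb => hb.1, ?_, ?_⟩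
      · rintro x (hx | ⟨hx, hax⟩) b hb hxb
        · exact Or.inl (hup x hx b hb hxb)
        · exact Or.inr ⟨hb, htrans _ ha _ hx _ hb hax hxb⟩
      · rintro x (hx | ⟨hx, hax⟩) y (hy | ⟨hy, hay⟩) hxy
        · exact hcons x hx y hy hxy
        · exact hlow x hx (htrans _ (hwE hx) _ (hc y hy) _ (hc a ha) hxy (hanti a ha y hy hay))
        · exact hlow y hy (hanti' a ha y (hwE hy)
            (htrans _ ha _ hx _ (hc y (hwE hy)) hax hxy))
        · exact hne a ha (htrans _ ha _ hx _ (hc a ha) hax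
            (htrans _ hx _ (hc y hy) _ (hc a ha) hxy (hanti a ha y hy hay)))
    exact hw.le_of_ge hw' Set.subset_union_left (Or.inr ⟨ha, hrefl a ha⟩)

/-- The translates of the members of a family and their complements. -/
def translates {ι : Type*} (X : ι → Set G) : Set (Set G) :=
  {A | ∃ (i : ι) (g : G), A = g • X i ∨ A = (g • X i)ᶜ}

theorem compl_mem_translates {ι : Type*} {X : ι → Set G} {A : Set G} (h : A ∈ translates X) :
    Aᶜ ∈ translates X := by
  obtain ⟨i, g, rfl | rfl⟩ := h
  · exact ⟨i, g, Or.inr rfl⟩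
  · exact ⟨i, g, Or.inl (compl_compl _)⟩

theorem smul_mem_translates {ι : Type*} {X : ι → Set G} {A : Set G} (h : A ∈ translates X)
    (k : G) : k • A ∈ translates X := by
  obtain ⟨i, g, rfl | rfl⟩ := h
  · exact ⟨i, k * g, Or.inl (smul_smul _ _ _)⟩
  · exact ⟨i, k * g, Or.inr (by rw [Set.smul_set_compl, smul_smul])⟩

theorem exists_isAI_of_mem_translates {ι : Type*} {H : ι → Subgroup G} {X : ι → Set G}
    (hX : ∀ i, IsAI (H i) (X i)) {A : Set G} (h : A ∈ translates X) : ∃ L, IsAI L A := by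
  obtain ⟨i, g, rfl | rfl⟩ := h
  · exact ⟨_, (hX i).smul g⟩
  · exact ⟨_, ((hX i).smul g).compl⟩

theorem hfinite_separated_from_translates (hG : Group.FG G) {ι : Type*} [Fintype ι]
    {H : ι → Subgroup G} (hH : ∀ i, (H i).FG) {X : ι → Set G} (hX : ∀ i, IsAI (H i) (X i))
    {K : Subgroup G} (hK : K.FG) {Y : Set G} (hY : IsAI K Y) :
    HFinite K {g | ∃ B ∈ translates X,
      SizeLE (g⁻¹ • Y) Bᶜ ∧ (1 : G) ∈ g⁻¹ • Y ∧ (1 : G) ∈ B} := by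
  refine ((HFinite.biUnion Finset.univ fun i _ =>
    hfinite_sizeLE_separated hG hK (hH i) hY (hX i)).union
    (HFinite.biUnion Finset.univ fun i _ =>
    hfinite_sizeLE_separated hG hK (hH i) hY (hX i).compl)).mono ?_
  rintro g ⟨B, ⟨i, k, rfl | rfl⟩, hle, h1, h2⟩
  · right
    simp only [Set.mem_iUnion]
    exact ⟨i, Finset.mem_univ _, k, by rwa [Set.smul_set_compl], h1,
      by rw [Set.smul_set_compl]; exact not_not.2 h2⟩
  · left
    simp only [Set.mem_iUnion]
    exact ⟨i, Finset.mem_univ _, k, by rwa [compl_compl] at hle, h1, h2⟩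

/-- With `P` the sets containing `1`, a translate on which `w` differs from the principal
ultrafilter at `1` is, itself or through its complement, a set containing `1` that precedes the
complement of another. `hfinite_separated_from_translates` bounds these. -/
theorem exists_ultrafilter_translates (hG : Group.FG G) {ι : Type*} [Fintype ι]
    {H : ι → Subgroup G} (hH : ∀ i, (H i).FG) {X : ι → Set G} (hX : ∀ i, IsAI (H i) (X i)) :
    ∃ w : Set (Set G), (∀ A ∈ w, ∀ B ∈ translates X, SizeLE A B → B ∈ w) ∧
      (∀ A ∈ translates X, A ∈ w ↔ Aᶜ ∉ w) ∧
      ∀ i, HFinite (H i) {g | ¬ (g⁻¹ • X i ∈ w ↔ g ∈ X i)} := by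
  have hAI : ∀ A ∈ translates X, ∃ L, IsAI L A := fun A => exists_isAI_of_mem_translates hX
  obtain ⟨w, -, hup, hcompl, hgood⟩ := exists_ultrafilter (E := translates X)
    (P := {A | (1 : G) ∈ A}) (r := SizeLE) (c := compl)
    (fun _ => compl_mem_translates) compl_compl (fun A _ => SizeLE.refl A)
    (fun A hA B hB C hC h h' => by
      obtain ⟨_, hA⟩ := hAI A hA
      obtain ⟨_, hB⟩ := hAI B hB
      obtain ⟨_, hC⟩ := hAI C hC
      exact h.trans hA hB hC h')
    (fun A hA B hB h => by
      obtain ⟨_, hA⟩ := hAI A hA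
      obtain ⟨_, hB⟩ := hAI B hB
      exact h.compl hA hB)
    (fun A hA => by
      obtain ⟨_, hA⟩ := hAI A hA
      exact SizeLE.not_compl hA)
  refine ⟨w, hup, hcompl, fun i => ?_⟩
  refine ((hfinite_separated_from_translates hG hH hX (hH i) (hX i)).union
    (hfinite_separated_from_translates hG hH hX (hH i) (hX i).compl)).mono fun g hg => ?_
  have hE : g⁻¹ • X i ∈ translates X := ⟨i, g⁻¹, Or.inl rfl⟩
  have hmem : (1 : G) ∈ g⁻¹ • X i ↔ g ∈ X i := by simp [Set.mem_smul_set_iff_inv_smul_mem]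
  have key : ∀ A ∈ translates X, (1 : G) ∈ A → A ∉ w →
      ∃ B ∈ translates X, SizeLE A Bᶜ ∧ (1 : G) ∈ A ∧ (1 : G) ∈ B := by
    intro A hA h1 hAw
    by_contra! hno
    exact hAw (hgood A hA h1 fun B hB hB1 hle => hno B hB hle h1 hB1)
  by_cases hgX : g ∈ X i
  · have hgw : g⁻¹ • X i ∉ w := fun h => hg (iff_of_true h hgX)
    exact Or.inl (key _ hE (hmem.2 hgX) hgw)
  · have hgw : g⁻¹ • X i ∈ w := by
      by_contra h
      exact hg (iff_of_false h hgX)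
    refine Or.inr ?_
    rw [Set.mem_ofPred_eq, Set.smul_set_compl]
    exact key _ (compl_mem_translates hE) (mt hmem.1 hgX) ((hcompl _ hE).1 hgw)

/-! ### Very good position of the orbit sets -/

theorem IsAI.of_hfinite_ne {H : Subgroup G} {X Z : Set G} (hX : IsAI H X)
    (hinv : ∀ h ∈ H, ∀ x, h * x ∈ Z ↔ x ∈ Z) (hd : HFinite H {x | ¬ (x ∈ Z ↔ x ∈ X)}) :
    IsAI H Z where
  mul_mem_iff := hinv
  hfinite g := (((hX.hfinite g).union hd).union (hd.mul_right g)).mono fun x hx => by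
    simp only [Set.mem_ofPred_eq, Set.mem_union] at hx ⊢
    tauto
  not_hfinite h := hX.not_hfinite ((h.union hd).mono fun x hx => by
    simp only [Set.mem_ofPred_eq, Set.mem_union]
    tauto)
  not_hfinite_compl h := hX.not_hfinite_compl ((h.union hd).mono fun x hx => by
    simp only [Set.mem_ofPred_eq, Set.mem_union, Set.mem_compl_iff] at hx ⊢
    tauto)

/-- The set of `g` such that `g⁻¹A` belongs to `w`: the half-space of `A` seen from the orbit of
the vertex `w` of the cubing dual to the family. -/
def orbitSet (w : Set (Set G)) (A : Set G) : Set G := {g | g⁻¹ • A ∈ w}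

theorem orbitSet_smul (w : Set (Set G)) (A : Set G) (g : G) :
    orbitSet w (g • A) = g • orbitSet w A := by
  ext x
  simp [orbitSet, Set.mem_smul_set_iff_inv_smul_mem, smul_smul]

/-- `U` is the set determined by `A` and `w`, and both are almost invariant over `L` and
equivalent. -/
structure Represents (w : Set (Set G)) (L : Subgroup G) (U A : Set G) : Prop where
  eq : U = orbitSet w A
  isAI_left : IsAI L U
  isAI_right : IsAI L A
  hfinite : HFinite L {x | ¬ (x ∈ U ↔ x ∈ A)}

theorem Represents.hfinite_diff {w : Set (Set G)} {L M : Subgroup G} {U V A B : Set G}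
    (hU : Represents w L U A) (hV : Represents w M V B) (h : HFinite L (U \ V)) :
    HFinite (MulAction.stabilizer G A) (A \ B) := by
  have h1 : HFinite M (U \ B) :=
    ((hU.isAI_left.hfinite_diff_swap hV.isAI_left h).union hV.hfinite).mono fun x hx => by
      simp only [Set.mem_ofPred_eq, Set.mem_union, Set.mem_sdiff] at hx ⊢
      tauto
  have h2 := hU.isAI_left.hfinite_diff_swap' hV.isAI_right h1
  refine hU.isAI_right.hfinite_iff_stabilizer.1 ((h2.union hU.hfinite).mono fun x hx => ?_)
  simp only [Set.mem_ofPred_eq, Set.mem_union, Set.mem_sdiff] at hx ⊢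
  tauto

/-- Smallness passes from `U \ V` to `A \ B`, so `A` and `B` are comparable. The tie-break may
favour `B`, hence the second alternative; either inclusion empties a corner. -/
theorem Represents.subset_or_subset {ι : Type*} {X : ι → Set G} {w : Set (Set G)}
    (hup : ∀ A ∈ w, ∀ B ∈ translates X, SizeLE A B → B ∈ w)
    {L M : Subgroup G} {U V A B : Set G} (hA : A ∈ translates X) (hB : B ∈ translates X)
    (hU : Represents w L U A) (hV : Represents w M V B) (h : HFinite L (U \ V)) :
    U ⊆ V ∨ V ⊆ U := by
  have mono : ∀ {C D : Set G}, D ∈ translates X → SizeLE C D → orbitSet w C ⊆ orbitSet w D :=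
    fun hD hle g hg => hup _ hg _ (smul_mem_translates hD _) (hle.smul _)
  rw [hU.eq, hV.eq]
  rcases SizeLE.total hU.isAI_right hV.isAI_right (hU.hfinite_diff hV h) with hle | hle
  · exact Or.inl (mono hB hle)
  · exact Or.inr (mono hA hle)

theorem Represents.compl {ι : Type*} {X : ι → Set G} {w : Set (Set G)}
    (hcompl : ∀ A ∈ translates X, A ∈ w ↔ Aᶜ ∉ w) {L : Subgroup G} {U A : Set G}
    (hA : A ∈ translates X) (hU : Represents w L U A) : Represents w L Uᶜ Aᶜ where
  eq := by
    rw [hU.eq]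
    ext g
    have := hcompl _ (smul_mem_translates hA g⁻¹)
    simp only [orbitSet, Set.mem_compl_iff, Set.mem_ofPred_eq, Set.smul_set_compl]
    tauto
  isAI_left := hU.isAI_left.compl
  isAI_right := hU.isAI_right.compl
  hfinite := hU.hfinite.mono fun x hx => by
    simp only [Set.mem_ofPred_eq, Set.mem_compl_iff] at hx ⊢
    tauto

theorem Represents.smul {w : Set (Set G)} {L : Subgroup G} {U A : Set G}
    (hU : Represents w L U A) (g : G) : Represents w (MulAut.conj g • L) (g • U) (g • A) where
  eq := by rw [orbitSet_smul, hU.eq]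
  isAI_left := hU.isAI_left.smul g
  isAI_right := hU.isAI_right.smul g
  hfinite := (hU.hfinite.smul g).mono fun x hx => by
    simpa only [Set.mem_smul_set_iff_inv_smul_mem, Set.mem_ofPred_eq] using hx

theorem Represents.crosses_or_nested {ι : Type*} {X : ι → Set G} {w : Set (Set G)}
    (hup : ∀ A ∈ w, ∀ B ∈ translates X, SizeLE A B → B ∈ w)
    (hcompl : ∀ A ∈ translates X, A ∈ w ↔ Aᶜ ∉ w)
    {L M : Subgroup G} {U V A B : Set G} (hA : A ∈ translates X) (hB : B ∈ translates X)
    (hU : Represents w L U A) (hV : Represents w M V B) : Crosses L U V ∨ Nested U V := by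
  have hU' := hU.compl hcompl hA
  have hV' := hV.compl hcompl hB
  have hA' := compl_mem_translates hA
  have hB' := compl_mem_translates hB
  by_cases hcr : Crosses L U V
  · exact Or.inl hcr
  refine Or.inr ?_
  simp only [Crosses, not_and_or, not_not] at hcr
  simp only [Nested, ← Set.disjoint_iff_inter_eq_empty]
  rcases hcr with h | h | h | h
  · rw [← compl_compl V, ← Set.sdiff_eq] at h
    rcases subset_or_subset hup hA hB' hU hV' h with h | h
    · exact Or.inl (Set.subset_compl_iff_disjoint_right.1 h)
    · exact Or.inr (Or.inr (Or.inr (Set.disjoint_left.2 fun x h1 h2 => h1 (h h2))))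
  · rw [← compl_compl V, ← Set.sdiff_eq] at h
    rcases subset_or_subset hup hA' hB' hU' hV' h with h | h
    · exact Or.inr (Or.inl (Set.disjoint_left.2 fun x h1 h2 => h h1 h2))
    · exact Or.inr (Or.inr (Or.inl (Set.disjoint_left.2 fun x h1 h2 => h h2 h1)))
  · rcases subset_or_subset hup hA hB hU hV h with h | h
    · exact Or.inr (Or.inr (Or.inl (Set.disjoint_left.2 fun x h1 h2 => h2 (h h1))))
    · exact Or.inr (Or.inl (Set.disjoint_left.2 fun x h1 h2 => h1 (h h2)))
  · rcases subset_or_subset hup hA' hB hU' hV h with h | h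
    · exact Or.inr (Or.inr (Or.inr (Set.disjoint_left.2 fun x h1 h2 => h2 (h h1))))
    · exact Or.inl (Set.disjoint_left.2 fun x h1 h2 => h h2 h1)

theorem VeryGoodPosition.almostLE_iff_subset {ι : Type*} {K : ι → Subgroup G} {Z : ι → Set G}
    (h : VeryGoodPosition K Z) {L M : Subgroup G} {U V : Set G} (hU : MemE K Z L U)
    (hV : MemE K Z M V) : AlmostLE L U V ↔ U ⊆ V := by
  rw [← Set.sdiff_eq_empty, Set.sdiff_eq]
  refine ⟨?_, Or.inl⟩
  rintro (h0 | ⟨h1, h2, h3, h4⟩)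
  · exact h0
  · have emp : ∀ {A : Set G}, A = ∅ → HFinite L A := fun e => e ▸ HFinite.empty
    rcases h L M U V hU hV with hc | hn | hn | hn | hn
    · exact absurd h1 hc.2.2.1
    · exact absurd (emp hn) h2
    · exact absurd (emp hn) h3
    · exact hn
    · exact absurd (emp hn) h4

end AlmostInv

open AlmostInv in
theorem mainTheorem2 {G : Type*} [Group G] (hG : Group.FG G) (n : ℕ)
    (H : Fin n → Subgroup G) (hH : ∀ i, (H i).FG)
    (X : Fin n → Set G) (hX : ∀ i, AlmostInv.IsNontrivialAlmostInvariant (H i) (X i)) :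
    ∃ (K : Fin n → Subgroup G) (Z : Fin n → Set G),
      (∀ i, AlmostInv.IsNontrivialAlmostInvariant (K i) (Z i)) ∧
      (∀ i, AlmostInv.Equivalent (H i) (X i) (K i) (Z i)) ∧
      AlmostInv.VeryGoodPosition K Z ∧
      (∀ (L M : Subgroup G) (U V : Set G),
        AlmostInv.MemE K Z L U → AlmostInv.MemE K Z M V →
          (AlmostInv.AlmostLE L U V ↔ U ⊆ V)) := by
  have hX' : ∀ i, IsAI (H i) (X i) := fun i => isNontrivialAlmostInvariant_iff.1 (hX i)
  obtain ⟨w, hup, hcompl, hfin⟩ := exists_ultrafilter_translates hG hH hX'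
  have hZ : ∀ i, IsAI (H i) (orbitSet w (X i)) := fun i =>
    (hX' i).of_hfinite_ne (fun h hh x => by
      have e : h⁻¹ • X i = X i := (hX' i).le_stabilizer ((H i).inv_mem hh)
      simp only [orbitSet, Set.mem_ofPred_eq, mul_inv_rev, mul_smul, e]) (hfin i)
  have hrep : ∀ i, Represents w (H i) (orbitSet w (X i)) (X i) := fun i =>
    ⟨rfl, hZ i, hX' i, hfin i⟩
  have hE : ∀ L U, MemE H (fun i => orbitSet w (X i)) L U →
      ∃ A ∈ translates X, Represents w L U A := by
    rintro _ _ ⟨i, g, rfl, rfl | rfl⟩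
    · exact ⟨_, ⟨i, g, Or.inl rfl⟩, (hrep i).smul g⟩
    · exact ⟨_, ⟨i, g, Or.inr rfl⟩, ((hrep i).smul g).compl hcompl ⟨i, g, Or.inl rfl⟩⟩
  have hV : VeryGoodPosition H (fun i => orbitSet w (X i)) := by
    intro L M U V hU hV
    obtain ⟨A, hA, hU⟩ := hE L U hU
    obtain ⟨B, hB, hV⟩ := hE M V hV
    exact hU.crosses_or_nested hup hcompl hA hB hV
  -- The groups need not change: `H i` fixes `X i`, hence also its orbit set.
  refine ⟨H, fun i => orbitSet w (X i), fun i => isNontrivialAlmostInvariant_iff.2 (hZ i),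
    fun i => ⟨(hX i).1, (isNontrivialAlmostInvariant_iff.2 (hZ i)).1, (hfin i).mono ?_⟩, hV,
    fun L M U V hU hV' => hV.almostLE_iff_subset hU hV'⟩
  intro g hg
  rw [Set.mem_symmDiff] at hg
  simp only [orbitSet, Set.mem_ofPred_eq] at hg ⊢
  tauto
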